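/- Let $\mathbb K$ be $\mathbb R$ or $\mathbb C$, let $c_0$ be the space of null sequences in $\mathbb K$ with the sup norm, and let $(e_i)_{i\ge 1}$ be its canonical unit vectors. For a continuous $m$-linear form $A:c_0\times\cdots\times c_0\to\mathbb K$ write $\|A\|=\sup\{|A(x_1,\dots,x_m)| : \|x_k\|\le 1,\ 1\le k\le m\}$. Let $m\ge 1$ and let $q_1,\dots,q_m\in[1,2]$. The following assertions are equivalent: (1) There is a constant $C=C_{q_1\dots q_m}\ge 1$ such that $$\left(\sum_{i_1=1}^{\infty}\left(\sum_{i_2=1}^{\infty}\left(\cdots\left(\sum_{i_{m-1}=1}^{\infty}\left(\sum_{i_m=1}^{\infty}|A(e_{i_1},\dots,e_{i_m})|^{q_m}\right)^{\frac{q_{m-1}}{q_m}}\right)^{\frac{q_{m-2}}{q_{m-1}}}\cdots\right)^{\frac{q_2}{q_3}}\right)^{\frac{q_1}{q_2}}\right)^{\frac1{q_1}}\le C\,\|A\|$$ for all continuous $m$-linear forms $A:c_0\times\cdots\times c_0\to\mathbb K$. (2) $\frac1{q_1}+\cdots+\frac1{q_m}\le\frac{m+1}{2}$. In particular (case $q_1=\cdots=q_m=\frac{2m}{m+1}$,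 the Bohnenblust–Hille inequality), for every $m\ge1$ there is a constant $C\ge1$ such that $$\left(\sum_{i_1,\dots,i_m=1}^{\infty}|A(e_{i_1},\dots,e_{i_m})|^{\frac{2m}{m+1}}\right)^{\frac{m+1}{2m}}\le C\,\|A\|$$ for all continuous $m$-linear forms $A:c_0\times\cdots\times c_0\to\mathbb K$. -/

import Mathlib

open scoped ENNReal ZeroAtInfty

/-- The `n`-th canonical unit vector of `c₀`. The space `c₀` of null sequences with the sup norm is
Mathlib's `C₀(ℕ, 𝕜)`: `ℕ` is discrete, so every sequence is continuous, and vanishing at infinity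
means tending to zero. -/
noncomputable def c0Basis (𝕜 : Type*) [RCLike 𝕜] (n : ℕ) : C₀(ℕ, 𝕜) where
  toFun := Pi.single n 1
  continuous_toFun := continuous_of_discreteTopology
  zero_at_infty' := by
    rw [Filter.cocompact_eq_cofinite]
    refine tendsto_const_nhds.congr' ?_
    have h : ∀ᶠ k in Filter.cofinite, k ∉ ({n} : Set ℕ) := (Set.finite_singleton n).compl_mem_cofinite
    filter_upwards [h] with k hk
    exact (Pi.single_eq_of_ne (M := fun _ : ℕ => 𝕜) (by simpa using hk) 1).symm

/-- The mixed norm `ℓ_{q 0}(ℓ_{q 1}(⋯(ℓ_{q (m-1)})))` of an array of nonnegative extended reals,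
with the sum over the first index outermost; the value `∞` is allowed. For `m = 2` it is
`(∑ i, (∑ j, a i j ^ q 1) ^ (q 0 / q 1)) ^ (1 / q 0)`. -/
noncomputable def mixedNorm : (m : ℕ) → (Fin m → ℝ) → ((Fin m → ℕ) → ℝ≥0∞) → ℝ≥0∞
  | 0, _, a => a Fin.elim0
  | m + 1, q, a =>
    (∑' i : ℕ, mixedNorm m (fun k => q k.succ) (fun j => a (Fin.cons i j)) ^ q 0) ^ (1 / q 0)

/-! Sufficiency of (2). Fix one index position `p`. Replacing the other variables by random signs,
Khinchine's inequality (`khinchine`) bounds the sum over that index of the ℓ₂ norms over all the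
others by a constant times `‖A‖` (`sum_sqrt_coeff_le`). Minkowski's inequality turns this into a
mixed norm bound with exponent 1 at `p` and 2 elsewhere (`mixedNorm_one_two_le`). Hölder's
inequality for mixed norms (`mixedNorm_le_prod`) interpolates between these `m` corner cases and
reaches every exponent vector in `[1,2]^m` with `∑ 1 / q k = (m + 1) / 2`. Smaller sums reduce to
this case by lowering the outermost exponent.

Necessity. Chaining Sylvester–Hadamard matrices along consecutive indices gives a form with
unimodular coefficients on a box of side `N = 2 ^ k` and norm at most `N ^ ((m + 1) / 2)`
(`exists_unimodular_form`), while its mixed norm is at least `N ^ ∑ 1 / q k`. Letting `k → ∞` forces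
(2). -/

/-- The sign `±1` attached to a Boolean. -/
noncomputable def boolSign (𝕜 : Type*) [RCLike 𝕜] (b : Bool) : 𝕜 := if b then 1 else -1

lemma norm_boolSign (𝕜 : Type*) [RCLike 𝕜] (b : Bool) : ‖boolSign 𝕜 b‖ = 1 := by
  cases b <;> simp [boolSign]

lemma sum_fin_succ_tuple {n : ℕ} {J M : Type*} [Fintype J] [AddCommMonoid M]
    (F : (Fin (n + 1) → J) → M) : ∑ r, F r = ∑ j, ∑ r : Fin n → J, F (Fin.cons j r) := by
  rw [← (Fin.consEquiv fun _ => J).sum_comp, Fintype.sum_prod_type]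
  simp [Fin.consEquiv]

lemma sum_fin_succ_bool {N : ℕ} {M : Type*} [AddCommMonoid M] (F : (Fin (N + 1) → Bool) → M) :
    ∑ s, F s = ∑ s : Fin N → Bool, (F (Fin.cons true s) + F (Fin.cons false s)) := by
  simp [sum_fin_succ_tuple, Finset.sum_add_distrib]

/-! ### Khinchine's inequality and the choice of signs. -/

section Khinchine

lemma norm_add_sq_add_norm_neg_add_sq (𝕜 : Type*) {H : Type*} [RCLike 𝕜]
    [NormedAddCommGroup H] [InnerProductSpace 𝕜 H] (v S : H) :
    ‖v + S‖ ^ 2 + ‖-v + S‖ ^ 2 = 2 * (‖v‖ ^ 2 + ‖S‖ ^ 2) := by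
  have h := parallelogram_law_with_norm 𝕜 S v
  rw [show v + S = S + v by abel, show -v + S = S - v by abel]
  linarith [h, sq ‖S + v‖, sq ‖S - v‖, sq ‖S‖, sq ‖v‖]

/-- The terms odd in `v` cancel. The coefficient 6 is 2 from squaring `‖v‖ ^ 2 + ‖S‖ ^ 2` plus 4
from Cauchy–Schwarz on the squared cross term. -/
lemma norm_add_pow_four_add_norm_neg_add_pow_four_le (𝕜 : Type*) {H : Type*} [RCLike 𝕜]
    [NormedAddCommGroup H] [InnerProductSpace 𝕜 H] (v S : H) :
    ‖v + S‖ ^ 4 + ‖-v + S‖ ^ 4 ≤ 2 * (‖v‖ ^ 4 + 6 * ‖v‖ ^ 2 * ‖S‖ ^ 2 + ‖S‖ ^ 4) := by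
  have h1 := @norm_add_sq 𝕜 H _ _ _ v S
  have h2 := norm_add_sq_add_norm_neg_add_sq 𝕜 v S
  have h3 : RCLike.re (inner 𝕜 v S) ^ 2 ≤ ‖v‖ ^ 2 * ‖S‖ ^ 2 := by
    rw [← mul_pow, ← sq_abs]
    exact pow_le_pow_left₀ (abs_nonneg _)
      ((RCLike.abs_re_le_norm _).trans (norm_inner_le_norm v S)) 2
  have h4 : ‖-v + S‖ ^ 2 = ‖v‖ ^ 2 - 2 * RCLike.re (inner 𝕜 v S) + ‖S‖ ^ 2 := by linarith
  rw [show ‖v + S‖ ^ 4 = (‖v + S‖ ^ 2) ^ 2 by ring,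
    show ‖-v + S‖ ^ 4 = (‖-v + S‖ ^ 2) ^ 2 by ring, h1, h4]
  nlinarith [h3]

variable (𝕜 : Type*) {H : Type*} [RCLike 𝕜] [NormedAddCommGroup H] [InnerProductSpace 𝕜 H]

lemma sum_norm_sq_rademacher {N : ℕ} (v : Fin N → H) :
    ∑ s : Fin N → Bool, ‖∑ j, boolSign 𝕜 (s j) • v j‖ ^ 2 = 2 ^ N * ∑ j, ‖v j‖ ^ 2 := by
  induction N with
  | zero => simp
  | succ N ih =>
    rw [sum_fin_succ_bool]
    simp only [Fin.sum_univ_succ, Fin.cons_zero, Fin.cons_succ]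
    simp only [boolSign, if_true, Bool.false_eq_true, if_false, one_smul, neg_smul]
    simp only [norm_add_sq_add_norm_neg_add_sq 𝕜]
    have := ih (fun j => v j.succ)
    simp only [boolSign, ite_smul, one_smul, neg_smul] at this ⊢
    rw [← Finset.mul_sum, Finset.sum_add_distrib, this]
    simp
    ring

lemma sum_norm_pow_four_rademacher_le {N : ℕ} (v : Fin N → H) :
    ∑ s : Fin N → Bool, ‖∑ j, boolSign 𝕜 (s j) • v j‖ ^ 4 ≤
      2 ^ N * (3 * (∑ j, ‖v j‖ ^ 2) ^ 2) := by
  induction N with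
  | zero => simp
  | succ N ih =>
    rw [sum_fin_succ_bool]
    have h2 := sum_norm_sq_rademacher 𝕜 (fun j => v j.succ)
    have h4 := ih (fun j => v j.succ)
    simp only [Fin.sum_univ_succ, Fin.cons_zero, Fin.cons_succ]
    set T : (Fin N → Bool) → H := fun s => ∑ j, boolSign 𝕜 (s j) • v j.succ with hT
    calc _ ≤ ∑ s : Fin N → Bool,
          2 * (‖v 0‖ ^ 4 + 6 * ‖v 0‖ ^ 2 * ‖T s‖ ^ 2 + ‖T s‖ ^ 4) := by
          refine Finset.sum_le_sum fun s _ => ?_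
          simpa [boolSign, hT] using
            norm_add_pow_four_add_norm_neg_add_pow_four_le 𝕜 (v 0) (T s)
      _ = 2 * (2 ^ N * ‖v 0‖ ^ 4 + 6 * ‖v 0‖ ^ 2 * ∑ s, ‖T s‖ ^ 2 + ∑ s, ‖T s‖ ^ 4) := by
          rw [← Finset.mul_sum, Finset.sum_add_distrib, Finset.sum_add_distrib, ← Finset.mul_sum]
          simp
      _ ≤ _ := by
          rw [h2]
          have : (0 : ℝ) ≤ 2 ^ N * ‖v 0‖ ^ 4 := by positivity
          generalize (∑ j : Fin N, ‖v j.succ‖ ^ 2) = t at h4 ⊢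
          generalize (∑ s : Fin N → Bool, ‖T s‖ ^ 4) = u at h4 ⊢
          rw [pow_succ (2 : ℝ)]
          generalize (2 : ℝ) ^ N = p at h4 this ⊢
          linarith

/-- Khinchine's inequality for Hilbert space valued Rademacher sums. -/
lemma khinchine {N : ℕ} (v : Fin N → H) :
    2 ^ N * √(∑ j, ‖v j‖ ^ 2) ≤
      9 / 5 * ∑ s : Fin N → Bool, ‖∑ j, boolSign 𝕜 (s j) • v j‖ := by
  set σ := √(∑ j, ‖v j‖ ^ 2) with hσ
  have hσ2 : ∑ j, ‖v j‖ ^ 2 = σ ^ 2 := (Real.sq_sqrt (by positivity)).symm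
  rcases (Real.sqrt_nonneg (∑ j, ‖v j‖ ^ 2)).eq_or_lt' with h0 | hpos
  · rw [hσ, h0]
    simp only [mul_zero]
    positivity
  rw [← hσ] at hpos
  have h2 := sum_norm_sq_rademacher 𝕜 v
  have h4 := sum_norm_pow_four_rademacher_le 𝕜 v
  rw [hσ2] at h2 h4
  -- A lower bound for the first moment by the second and fourth, tangent at `x = 3σ/2`. Averaging
  -- leaves `1 - 3 * 4 / 27 = 5 / 9`, whence the constant `9 / 5`.
  have key : ∀ x : ℝ, 0 ≤ x → σ ^ 2 * x ^ 2 - 4 / 27 * x ^ 4 ≤ σ ^ 3 * x := by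
    intro x hx
    have : 0 ≤ x * (x - 3 / 2 * σ) ^ 2 * (x + 3 * σ) := by positivity
    nlinarith [this]
  have hsum := Finset.sum_le_sum fun (s : Fin N → Bool) (_ : s ∈ Finset.univ) =>
    key _ (norm_nonneg (∑ j, boolSign 𝕜 (s j) • v j))
  rw [Finset.sum_sub_distrib, ← Finset.mul_sum, ← Finset.mul_sum, ← Finset.mul_sum, h2] at hsum
  refine le_of_mul_le_mul_left ?_ (pow_pos hpos 3)
  nlinarith [hsum, h4]

lemma exists_signs_sum_sqrt_le {ι : Type*} [Fintype ι] {N : ℕ} (v : ι → Fin N → H) :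
    ∃ ε : Fin N → 𝕜, (∀ j, ‖ε j‖ ≤ 1) ∧
      ∑ i, √(∑ j, ‖v i j‖ ^ 2) ≤ 9 / 5 * ∑ i, ‖∑ j, ε j • v i j‖ := by
  have h : ∑ _s : Fin N → Bool, ∑ i, √(∑ j, ‖v i j‖ ^ 2) ≤
      ∑ s : Fin N → Bool, 9 / 5 * ∑ i, ‖∑ j, boolSign 𝕜 (s j) • v i j‖ := by
    rw [← Finset.mul_sum, Finset.sum_comm, Finset.sum_comm (s := Finset.univ (α := Fin N → Bool)),
      Finset.mul_sum]
    refine Finset.sum_le_sum fun i _ => ?_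
    simpa using khinchine 𝕜 (v i)
  obtain ⟨s, -, hs⟩ := Finset.exists_le_of_sum_le Finset.univ_nonempty h
  exact ⟨fun j => boolSign 𝕜 (s j), fun j => (norm_boolSign 𝕜 _).le, hs⟩

end Khinchine

/-- Indices are removed one at a time. Hilbert-valued Khinchine treats the first index while the
remaining ones stay inside a Euclidean norm, so each index costs one factor `9 / 5`. -/
lemma exists_signs_sum_sqrt_multi_le {𝕜 ι : Type*} [RCLike 𝕜] [Fintype ι] {N : ℕ} (n : ℕ)
    (c : ι → (Fin n → Fin N) → 𝕜) :
    ∃ ε : Fin n → Fin N → 𝕜, (∀ k j, ‖ε k j‖ ≤ 1) ∧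
      ∑ i, √(∑ r, ‖c i r‖ ^ 2) ≤ (9 / 5) ^ n * ∑ i, ‖∑ r, (∏ k, ε k (r k)) * c i r‖ := by
  induction n with
  | zero => exact ⟨fun _ _ => 0, by simp, by simp⟩
  | succ n ih =>
    obtain ⟨ε, hε, h⟩ := exists_signs_sum_sqrt_le 𝕜
      (fun i (j : Fin N) => (WithLp.toLp 2 fun r => c i (Fin.cons j r) :
        EuclideanSpace 𝕜 (Fin n → Fin N)))
    obtain ⟨δ, hδ, h'⟩ := ih (fun i r => ∑ j, ε j * c i (Fin.cons j r))
    refine ⟨Fin.cons ε δ, ?_, ?_⟩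
    · intro k
      refine Fin.cases ?_ (fun k => ?_) k
      · simpa using hε
      · simpa using hδ k
    · simp only [sum_fin_succ_tuple (n := n)]
      simp only [EuclideanSpace.norm_eq, Real.sq_sqrt (Finset.sum_nonneg fun _ _ => sq_nonneg _)] at h
      simp only [WithLp.ofLp_sum, WithLp.ofLp_smul, Finset.sum_apply, Pi.smul_apply,
        smul_eq_mul] at h
      refine h.trans ?_
      rw [pow_succ', mul_assoc]
      refine mul_le_mul_of_nonneg_left (h'.trans (le_of_eq ?_)) (by norm_num)
      congr 1
      refine Finset.sum_congr rfl fun i _ => ?_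
      congr 1
      simp only [Finset.mul_sum]
      rw [Finset.sum_comm]
      simp only [Fin.prod_univ_succ, Fin.cons_zero, Fin.cons_succ]
      refine Finset.sum_congr rfl fun j _ => Finset.sum_congr rfl fun r _ => ?_
      ring

/-! ### Bounds for the coefficients on a finite box. -/

section Coefficients

variable {𝕜 : Type*} [RCLike 𝕜]

lemma c0Basis_apply (n k : ℕ) : c0Basis 𝕜 n k = (Pi.single n 1 : ℕ → 𝕜) k := rfl

lemma ZeroAtInftyContinuousMap.norm_apply_le (f : C₀(ℕ, 𝕜)) (n : ℕ) : ‖f n‖ ≤ ‖f‖ := by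
  rw [← ZeroAtInftyContinuousMap.norm_toBCF_eq_norm]
  exact f.toBCF.norm_coe_le_norm n

lemma ZeroAtInftyContinuousMap.norm_le_of_forall {f : C₀(ℕ, 𝕜)} {C : ℝ} (hC : 0 ≤ C)
    (h : ∀ n, ‖f n‖ ≤ C) : ‖f‖ ≤ C := by
  rw [← ZeroAtInftyContinuousMap.norm_toBCF_eq_norm]
  exact (BoundedContinuousFunction.norm_le hC).2 h

lemma ZeroAtInftyContinuousMap.sum_apply {ι : Type*} (s : Finset ι) (f : ι → C₀(ℕ, 𝕜)) (n : ℕ) :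
    (∑ i ∈ s, f i) n = ∑ i ∈ s, f i n := by
  classical
  induction s using Finset.induction_on with
  | empty => simp
  | insert a s ha ih => simp [Finset.sum_insert ha, ih]

lemma norm_sum_smul_c0Basis_le {N : ℕ} (y : Fin N → 𝕜) (hy : ∀ j, ‖y j‖ ≤ 1) :
    ‖∑ j : Fin N, y j • c0Basis 𝕜 j‖ ≤ 1 := by
  refine ZeroAtInftyContinuousMap.norm_le_of_forall zero_le_one fun n => ?_
  rw [ZeroAtInftyContinuousMap.sum_apply]
  simp only [ZeroAtInftyContinuousMap.smul_apply, c0Basis_apply, smul_eq_mul]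
  by_cases hn : n < N
  · rw [Finset.sum_eq_single ⟨n, hn⟩]
    · simpa using hy _
    · intro j _ hj
      rw [Pi.single_eq_of_ne, mul_zero]
      rintro rfl
      exact hj rfl
    · simp
  · rw [Finset.sum_eq_zero]
    · simp
    · intro j _
      rw [Pi.single_eq_of_ne, mul_zero]
      rintro rfl
      exact hn j.2

lemma norm_sum_prod_mul_coeff_le {m N : ℕ}
    (A : ContinuousMultilinearMap 𝕜 (fun _ : Fin m => C₀(ℕ, 𝕜)) 𝕜) (y : Fin m → Fin N → 𝕜)
    (hy : ∀ k j, ‖y k j‖ ≤ 1) :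
    ‖∑ r : Fin m → Fin N, (∏ k, y k (r k)) * A (fun k => c0Basis 𝕜 (r k))‖ ≤ ‖A‖ := by
  have h : A (fun k => ∑ j : Fin N, y k j • c0Basis 𝕜 j) =
      ∑ r : Fin m → Fin N, (∏ k, y k (r k)) * A (fun k => c0Basis 𝕜 (r k)) := by
    rw [A.map_sum]
    refine Finset.sum_congr rfl fun r _ => ?_
    rw [A.map_smul_univ, smul_eq_mul]
  rw [← h]
  refine (A.le_opNorm _).trans (mul_le_of_le_one_right (norm_nonneg _) ?_)
  exact Finset.prod_le_one (fun _ _ => norm_nonneg _)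
    fun k _ => norm_sum_smul_c0Basis_le _ (hy k)

lemma sum_sqrt_coeff_le {n N : ℕ}
    (A : ContinuousMultilinearMap 𝕜 (fun _ : Fin (n + 1) => C₀(ℕ, 𝕜)) 𝕜) (p : Fin (n + 1)) :
    ∑ l : Fin N, √(∑ r : Fin n → Fin N,
      ‖A (fun k => c0Basis 𝕜 ((p.insertNth l r : Fin (n + 1) → Fin N) k))‖ ^ 2) ≤
        (9 / 5) ^ n * ‖A‖ := by
  obtain ⟨ε, hε, h⟩ := exists_signs_sum_sqrt_multi_le n fun (l : Fin N) (r : Fin n → Fin N) =>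
    A (fun k => c0Basis 𝕜 ((p.insertNth l r : Fin (n + 1) → Fin N) k))
  refine h.trans (mul_le_mul_of_nonneg_left ?_ (by positivity))
  set z : Fin N → 𝕜 := fun l => ∑ r : Fin n → Fin N, (∏ k, ε k (r k)) *
    A (fun k => c0Basis 𝕜 ((p.insertNth l r : Fin (n + 1) → Fin N) k)) with hz
  -- With the signs `ε` in the other slots, the phases `u` inserted in slot `p` turn `∑ ‖z l‖` into
  -- a single value of `A` on the unit ball.
  choose u hu hu' using fun l => RCLike.exists_norm_eq_mul_self (z l)
  have key := norm_sum_prod_mul_coeff_le A (p.insertNth u ε : Fin (n + 1) → Fin N → 𝕜) (by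
    intro k
    refine Fin.succAboveCases p ?_ (fun k => ?_) k
    · simpa using fun j => (hu j).le
    · simpa using hε k)
  have hsum : ∑ r : Fin (n + 1) → Fin N,
      (∏ k, (p.insertNth u ε : Fin (n + 1) → Fin N → 𝕜) k (r k)) *
        A (fun k => c0Basis 𝕜 (r k)) = ((∑ l, ‖z l‖ : ℝ) : 𝕜) := by
    rw [← (Fin.insertNthEquiv (fun _ => Fin N) p).sum_comp, Fintype.sum_prod_type]
    push_cast
    refine Finset.sum_congr rfl fun l _ => ?_
    refine Eq.trans ?_ (hu' l).symm
    rw [hz, Finset.mul_sum]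
    refine Finset.sum_congr rfl fun r _ => ?_
    rw [Fin.prod_univ_succAbove _ p]
    simp [Fin.insertNthEquiv, mul_assoc]
  rw [hsum, RCLike.norm_ofReal] at key
  exact (le_abs_self _).trans key

end Coefficients

/-! ### Passage from finite boxes to infinite sums. -/

/-- The multi-indices with all entries below `N`. -/
def boxFinset (n N : ℕ) : Finset (Fin n → ℕ) :=
  Finset.univ.map ⟨fun (r : Fin n → Fin N) k => (r k : ℕ),
    fun _ _ h => funext fun k => Fin.ext (congrFun h k)⟩

lemma mem_boxFinset {n N : ℕ} {i : Fin n → ℕ} : i ∈ boxFinset n N ↔ ∀ k, i k < N := by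
  simp only [boxFinset, Finset.mem_map, Finset.mem_univ, true_and]
  constructor
  · rintro ⟨r, rfl⟩ k
    exact (r k).2
  · exact fun h => ⟨fun k => ⟨i k, h k⟩, rfl⟩

lemma tendsto_boxFinset (n : ℕ) : Filter.Tendsto (boxFinset n) Filter.atTop Filter.atTop := by
  refine Filter.tendsto_atTop_finset_of_monotone (fun N N' h i hi => ?_) fun i => ?_
  · rw [mem_boxFinset] at hi ⊢
    exact fun k => (hi k).trans_le h
  · refine ⟨∑ k, i k + 1, mem_boxFinset.2 fun k => Nat.lt_succ_of_le ?_⟩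
    exact Finset.single_le_sum (f := i) (fun _ _ => Nat.zero_le _) (Finset.mem_univ k)

lemma ENNReal.ofReal_sqrt {x : ℝ} (hx : 0 ≤ x) :
    ENNReal.ofReal √x = ENNReal.ofReal x ^ (1 / 2 : ℝ) := by
  rw [Real.sqrt_eq_rpow, ENNReal.ofReal_rpow_of_nonneg hx (by norm_num)]

lemma tsum_rpow_half_le_of_box {E : Type*} [NormedAddCommGroup E] {n : ℕ}
    (b : ℕ → (Fin n → ℕ) → E) {M : ℝ}
    (h : ∀ N : ℕ, ∑ l : Fin N, √(∑ r : Fin n → Fin N, ‖b l (fun k => r k)‖ ^ 2) ≤ M) :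
    ∑' l, (∑' i, ‖b l i‖ₑ ^ (2 : ℝ)) ^ (1 / 2 : ℝ) ≤ ENNReal.ofReal M := by
  refine ENNReal.tsum_le_of_sum_range_le fun L => ?_
  have hlim : Filter.Tendsto (fun N => ∑ l ∈ Finset.range L,
      (∑ i ∈ boxFinset n N, ‖b l i‖ₑ ^ (2 : ℝ)) ^ (1 / 2 : ℝ)) Filter.atTop
      (nhds (∑ l ∈ Finset.range L, (∑' i, ‖b l i‖ₑ ^ (2 : ℝ)) ^ (1 / 2 : ℝ))) :=
    tendsto_finsetSum _ fun l _ =>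
      (ENNReal.continuous_rpow_const.tendsto _).comp
        (ENNReal.summable.hasSum.comp (tendsto_boxFinset n))
  -- Once `N ≥ L`, the outer range can be enlarged to the side of the box, where `h` applies.
  refine le_of_tendsto hlim ((Filter.eventually_ge_atTop L).mono fun N hN => ?_)
  refine (Finset.sum_le_sum_of_subset (Finset.range_mono hN)).trans ?_
  refine le_trans (le_of_eq ?_) (ENNReal.ofReal_le_ofReal (h N))
  rw [Finset.sum_range, ENNReal.ofReal_sum_of_nonneg fun _ _ => Real.sqrt_nonneg _]
  refine Finset.sum_congr rfl fun l _ => ?_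
  rw [ENNReal.ofReal_sqrt (by positivity), ENNReal.ofReal_sum_of_nonneg fun _ _ => by positivity,
    boxFinset, Finset.sum_map]
  congr 1
  refine Finset.sum_congr rfl fun r _ => ?_
  rw [ENNReal.ofReal_pow (norm_nonneg _), ofReal_norm, ENNReal.rpow_two]
  rfl

lemma tsum_coeff_rpow_half_le {𝕜 : Type*} [RCLike 𝕜] {n : ℕ}
    (A : ContinuousMultilinearMap 𝕜 (fun _ : Fin (n + 1) => C₀(ℕ, 𝕜)) 𝕜) (p : Fin (n + 1)) :
    ∑' l, (∑' i, ‖A (fun k => c0Basis 𝕜 ((p.insertNth l i : Fin (n + 1) → ℕ) k))‖ₑ ^ (2 : ℝ)) ^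
      (1 / 2 : ℝ) ≤ ENNReal.ofReal ((9 / 5) ^ n * ‖A‖) := by
  refine tsum_rpow_half_le_of_box
    (fun l i => A (fun k => c0Basis 𝕜 ((p.insertNth l i : Fin (n + 1) → ℕ) k))) fun N => ?_
  have hcast : ∀ (l : Fin N) (r : Fin n → Fin N) (k : Fin (n + 1)),
      (p.insertNth (l : ℕ) (fun k => (r k : ℕ)) : Fin (n + 1) → ℕ) k =
        ((p.insertNth l r : Fin (n + 1) → Fin N) k : ℕ) := fun l r k => by
    refine Fin.succAboveCases p ?_ (fun k => ?_) k <;> simp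
  simpa only [hcast] using sum_sqrt_coeff_le (N := N) A p

/-! ### Minkowski, Hölder and monotonicity for mixed norms. -/

/-- Minkowski's inequality for the mixed norms `ℓ₂(ℓ₁)` and `ℓ₁(ℓ₂)`. -/
lemma ENNReal.tsum_tsum_rpow_two_le {α β : Type*} (f : α → β → ℝ≥0∞) :
    (∑' i, (∑' l, f i l) ^ (2 : ℝ)) ^ (1 / 2 : ℝ) ≤
      ∑' l, (∑' i, f i l ^ (2 : ℝ)) ^ (1 / 2 : ℝ) := by
  let _ : MeasurableSpace α := ⊤
  -- Expanding the square of the inner sum gives a double sum over `l, l'`, to be bounded termwise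
  -- by Cauchy–Schwarz.
  have hcs : ∀ l l', ∑' i, f i l * f i l' ≤
      (∑' i, f i l ^ (2 : ℝ)) ^ (1 / 2 : ℝ) * (∑' i, f i l' ^ (2 : ℝ)) ^ (1 / 2 : ℝ) := by
    intro l l'
    have := ENNReal.lintegral_mul_le_Lp_mul_Lq (MeasureTheory.Measure.count (α := α))
      Real.HolderConjugate.two_two (f := fun i => f i l) (g := fun i => f i l')
      (measurable_from_top.aemeasurable) (measurable_from_top.aemeasurable)
    simpa [MeasureTheory.lintegral_count] using this
  have hsq : ∑' i, (∑' l, f i l) ^ (2 : ℝ) ≤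
      (∑' l, (∑' i, f i l ^ (2 : ℝ)) ^ (1 / 2 : ℝ)) ^ (2 : ℝ) := by
    simp only [ENNReal.rpow_two, sq] at hcs ⊢
    simp only [← ENNReal.tsum_mul_left, ← ENNReal.tsum_mul_right]
    rw [ENNReal.tsum_comm]
    refine ENNReal.tsum_le_tsum fun l => ?_
    rw [ENNReal.tsum_comm]
    exact ENNReal.tsum_le_tsum fun l' => by simpa [mul_comm] using hcs l l'
  calc _ ≤ _ := ENNReal.rpow_le_rpow hsq (by norm_num)
    _ = _ := by rw [← ENNReal.rpow_mul]; norm_num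

lemma tsum_fin_succ_tuple {n : ℕ} (F : (Fin (n + 1) → ℕ) → ℝ≥0∞) :
    ∑' r, F r = ∑' j, ∑' r : Fin n → ℕ, F (Fin.cons j r) := by
  rw [← (Fin.consEquiv fun _ => ℕ).tsum_eq, ENNReal.tsum_prod']
  simp [Fin.consEquiv]

lemma mixedNorm_const {p : ℝ} (hp : 0 < p) (m : ℕ) (a : (Fin m → ℕ) → ℝ≥0∞) :
    mixedNorm m (fun _ => p) a = (∑' i, a i ^ p) ^ (1 / p) := by
  have hp' := hp.ne'
  induction m with
  | zero =>
    rw [tsum_eq_single Fin.elim0 fun i hi => (hi (Subsingleton.elim _ _)).elim, ← ENNReal.rpow_mul]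
    simp [mixedNorm, hp']
  | succ m ih =>
    simp only [mixedNorm, ih, ← ENNReal.rpow_mul]
    rw [tsum_fin_succ_tuple]
    simp [hp']

lemma ENNReal.rpow_sum_of_nonneg {ι : Type*} (x : ℝ≥0∞) (s : Finset ι) {θ : ι → ℝ}
    (hθ : ∀ j ∈ s, 0 ≤ θ j) : x ^ ∑ j ∈ s, θ j = ∏ j ∈ s, x ^ θ j := by
  classical
  induction s using Finset.induction_on with
  | empty => simp
  | insert b s hb ih =>
    have hs : ∀ j ∈ s, 0 ≤ θ j := fun j hj => hθ j (Finset.mem_insert_of_mem hj)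
    rw [Finset.sum_insert hb, Finset.prod_insert hb, ENNReal.rpow_add_of_nonneg _ _
      (hθ b (Finset.mem_insert_self b s)) (Finset.sum_nonneg hs), ih hs]

/-- Hölder's inequality for mixed norms. -/
lemma mixedNorm_le_prod {ι : Type*} [Fintype ι] (θ : ι → ℝ) (hθ : ∀ j, 0 ≤ θ j)
    (hθ1 : ∑ j, θ j = 1) (m : ℕ) (q : Fin m → ℝ) (Q : ι → Fin m → ℝ) (hq : ∀ k, 0 < q k)
    (hQ : ∀ j k, 0 < Q j k) (h : ∀ k, 1 / q k = ∑ j, θ j / Q j k) (a : (Fin m → ℕ) → ℝ≥0∞) :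
    mixedNorm m q a ≤ ∏ j, mixedNorm m (Q j) a ^ θ j := by
  have hprod : ∀ x : ℝ≥0∞, ∏ j, x ^ θ j = x := by
    intro x
    rw [← ENNReal.rpow_sum_of_nonneg _ _ fun j _ => hθ j, hθ1, ENNReal.rpow_one]
  induction m with
  | zero => simp [mixedNorm, hprod]
  | succ m ih =>
    simp only [mixedNorm]
    have h0 := h 0
    -- These are the Hölder weights for the outermost sum; the relation `h 0` between the exponents
    -- says exactly that they add up to 1.
    have hw : ∑ j, q 0 * θ j / Q j 0 = 1 := by
      have := (hq 0).ne'
      simp only [mul_div_assoc]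
      rw [← Finset.mul_sum, ← h0]
      field_simp
    calc _ ≤ (∑' i, ∏ j, (mixedNorm m (fun k => Q j k.succ)
            (fun r => a (Fin.cons i r)) ^ Q j 0) ^ (q 0 * θ j / Q j 0)) ^ (1 / q 0) := by
          refine ENNReal.rpow_le_rpow (ENNReal.tsum_le_tsum fun i => ?_)
            (one_div_nonneg.2 (hq 0).le)
          refine (ENNReal.rpow_le_rpow (ih (fun k => q k.succ) (fun j k => Q j k.succ)
            (fun k => hq _) (fun j k => hQ _ _) (fun k => h _) _) (hq 0).le).trans ?_
          rw [← ENNReal.prod_rpow_of_nonneg (hq 0).le]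
          refine Finset.prod_le_prod' fun j _ => le_of_eq ?_
          rw [← ENNReal.rpow_mul, ← ENNReal.rpow_mul]
          congr 1
          have := (hQ j 0).ne'
          field_simp
      _ ≤ (∏ j, (∑' i, mixedNorm m (fun k => Q j k.succ)
            (fun r => a (Fin.cons i r)) ^ Q j 0) ^ (q 0 * θ j / Q j 0)) ^ (1 / q 0) := by
          refine ENNReal.rpow_le_rpow ?_ (one_div_nonneg.2 (hq 0).le)
          have := ENNReal.lintegral_prod_norm_pow_le (μ := MeasureTheory.Measure.count (α := ℕ))
            Finset.univ (f := fun j i => mixedNorm m (fun k => Q j k.succ)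
              (fun r => a (Fin.cons i r)) ^ Q j 0)
            (fun _ _ => (measurable_of_countable _).aemeasurable) hw
            (fun j _ => div_nonneg (mul_nonneg (hq 0).le (hθ j)) (hQ j 0).le)
          simpa only [MeasureTheory.lintegral_count] using this
      _ = _ := by
          rw [← ENNReal.prod_rpow_of_nonneg (one_div_nonneg.2 (hq 0).le)]
          refine Finset.prod_congr rfl fun j _ => ?_
          rw [← ENNReal.rpow_mul, ← ENNReal.rpow_mul]
          congr 1
          have := (hQ j 0).ne'
          have := (hq 0).ne'
          field_simp

lemma ENNReal.tsum_rpow_le_of_le {α : Type*} (f : α → ℝ≥0∞) {p q : ℝ} (hp : 0 < p) (hpq : p ≤ q) :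
    (∑' i, f i ^ q) ^ (1 / q) ≤ (∑' i, f i ^ p) ^ (1 / p) := by
  have hq := hp.trans_le hpq
  have key : ∑' i, f i ^ q ≤ (∑' i, f i ^ p) ^ (q / p) := by
    have hi : ∀ i, f i ^ (q - p) ≤ (∑' i, f i ^ p) ^ ((q - p) / p) := fun i => by
      calc f i ^ (q - p) = (f i ^ p) ^ ((q - p) / p) := by
            rw [← ENNReal.rpow_mul]; congr 1; field_simp
        _ ≤ _ := ENNReal.rpow_le_rpow (ENNReal.le_tsum i) (div_nonneg (sub_nonneg.2 hpq) hp.le)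
    calc ∑' i, f i ^ q = ∑' i, f i ^ p * f i ^ (q - p) := by
          refine tsum_congr fun i => ?_
          rw [← ENNReal.rpow_add_of_nonneg _ _ hp.le (sub_nonneg.2 hpq)]
          congr 1; ring
      _ ≤ ∑' i, f i ^ p * (∑' i, f i ^ p) ^ ((q - p) / p) :=
          ENNReal.tsum_le_tsum fun i => mul_le_mul_right (hi i) _
      _ = (∑' i, f i ^ p) ^ (1 : ℝ) * (∑' i, f i ^ p) ^ ((q - p) / p) := by
          rw [ENNReal.tsum_mul_right, ENNReal.rpow_one]
      _ = _ := by
          rw [← ENNReal.rpow_add_of_nonneg _ _ zero_le_one (div_nonneg (sub_nonneg.2 hpq) hp.le)]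
          congr 1; field_simp; ring
  calc _ ≤ _ := ENNReal.rpow_le_rpow key (one_div_nonneg.2 hq.le)
    _ = _ := by rw [← ENNReal.rpow_mul]; congr 1; field_simp

lemma mixedNorm_cons_le_of_le {m : ℕ} {s : ℝ} (q : Fin (m + 1) → ℝ) (hs : 0 < s) (hsq : s ≤ q 0)
    (a : (Fin (m + 1) → ℕ) → ℝ≥0∞) :
    mixedNorm (m + 1) q a ≤ mixedNorm (m + 1) (Fin.cons s fun k => q k.succ) a := by
  simpa only [mixedNorm, Fin.cons_zero, Fin.cons_succ] using
    ENNReal.tsum_rpow_le_of_le _ hs hsq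

/-- Each ℓ₂ sum standing outside the ℓ₁ sum at `p` is moved inside it by Minkowski's inequality,
which can only increase the value. -/
lemma mixedNorm_one_two_le {n : ℕ} (p : Fin (n + 1)) (a : (Fin (n + 1) → ℕ) → ℝ≥0∞) :
    mixedNorm (n + 1) (fun k => if k = p then 1 else 2) a ≤
      ∑' l, (∑' i : Fin n → ℕ, a (p.insertNth l i) ^ (2 : ℝ)) ^ (1 / 2 : ℝ) := by
  induction n with
  | zero =>
    obtain rfl : p = 0 := Fin.eq_zero p
    simp only [mixedNorm, Fin.insertNth_zero']
    simp only [if_true, ENNReal.rpow_one, div_one]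
    refine ENNReal.tsum_le_tsum fun l => ?_
    rw [tsum_eq_single Fin.elim0 fun i hi => (hi (Subsingleton.elim _ _)).elim, ← ENNReal.rpow_mul]
    norm_num
  | succ n ih =>
    refine Fin.cases ?_ (fun p => ?_) p
    · rw [mixedNorm]
      simp [Fin.succ_ne_zero, mixedNorm_const two_pos, Fin.insertNth_zero']
    · rw [mixedNorm]
      simp only [Fin.succ_inj, (Fin.succ_ne_zero p).symm, if_false]
      calc _ ≤ (∑' i, (∑' l, (∑' r : Fin n → ℕ,
              a (Fin.cons i (p.insertNth l r)) ^ (2 : ℝ)) ^ (1 / 2 : ℝ)) ^ (2 : ℝ)) ^ (1 / 2 : ℝ) :=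
            ENNReal.rpow_le_rpow (ENNReal.tsum_le_tsum fun i =>
              ENNReal.rpow_le_rpow (ih p _) (by norm_num)) (by norm_num)
        _ ≤ _ := ENNReal.tsum_tsum_rpow_two_le _
        _ = _ := by
            refine tsum_congr fun l => ?_
            simp only [← ENNReal.rpow_mul]
            rw [tsum_fin_succ_tuple]
            simp only [Fin.insertNth_succ_cons]
            norm_num

/-! ### Interpolation and the sufficiency of (2). -/

/-- The mixed norm inequality on the hyperplane `∑ 1 / q k = (n + 2) / 2`, with `n + 1` indices. -/
lemma mixedNorm_le_of_sum_eq {𝕜 : Type*} [RCLike 𝕜] {n : ℕ} (q : Fin (n + 1) → ℝ)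
    (hq : ∀ k, q k ∈ Set.Icc (1 : ℝ) 2) (hsum : ∑ k, 1 / q k = ((n : ℝ) + 2) / 2)
    (A : ContinuousMultilinearMap 𝕜 (fun _ : Fin (n + 1) => C₀(ℕ, 𝕜)) 𝕜) :
    mixedNorm (n + 1) q (fun i => ‖A (fun k => c0Basis 𝕜 (i k))‖ₑ) ≤
      ENNReal.ofReal ((9 / 5) ^ n * ‖A‖) := by
  -- The weights solve `1 / q k = θ k + (1 - θ k) / 2`. They are nonnegative because `q j ≤ 2`, and
  -- they sum to 1 exactly on the hyperplane.
  have hθ : ∀ j, 0 ≤ 2 * (1 / q j) - 1 := fun j => by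
    have := one_div_le_one_div_of_le (zero_lt_one.trans_le (hq j).1) (hq j).2
    linarith
  have hθ1 : ∑ j, (2 * (1 / q j) - 1) = 1 := by
    rw [Finset.sum_sub_distrib, ← Finset.mul_sum, hsum]
    simp
    ring
  refine (mixedNorm_le_prod (fun j => 2 * (1 / q j) - 1) hθ hθ1 (n + 1) q
    (fun j k => if k = j then 1 else 2) (fun k => zero_lt_one.trans_le (hq k).1)
    (fun j k => by split_ifs <;> norm_num) (fun k => ?_) _).trans ?_
  · have hsplit : ∀ j, (2 * (1 / q j) - 1) / (if k = j then (1 : ℝ) else 2) =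
        (2 * (1 / q j) - 1) / 2 + if k = j then (2 * (1 / q j) - 1) / 2 else 0 := fun j => by
      split_ifs <;> ring
    simp only [hsplit, Finset.sum_add_distrib, ← Finset.sum_div, hθ1]
    simp
    ring
  · refine (Finset.prod_le_prod' fun j _ => ENNReal.rpow_le_rpow
      ((mixedNorm_one_two_le j _).trans (tsum_coeff_rpow_half_le A j)) (hθ j)).trans ?_
    rw [← ENNReal.rpow_sum_of_nonneg _ _ fun j _ => hθ j, hθ1, ENNReal.rpow_one]

lemma mixedNorm_le_of_sum_le {𝕜 : Type*} [RCLike 𝕜] {n : ℕ} (q : Fin (n + 1) → ℝ)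
    (hq : ∀ k, q k ∈ Set.Icc (1 : ℝ) 2) (hsum : ∑ k, 1 / q k ≤ ((n : ℝ) + 2) / 2)
    (A : ContinuousMultilinearMap 𝕜 (fun _ : Fin (n + 1) => C₀(ℕ, 𝕜)) 𝕜) :
    mixedNorm (n + 1) q (fun i => ‖A (fun k => c0Basis 𝕜 (i k))‖ₑ) ≤
      ENNReal.ofReal ((9 / 5) ^ n * ‖A‖) := by
  -- Replacing `q 0` by `1 / t` lands on the hyperplane. As the other reciprocals are at least `1 /
  -- 2`, `t ≤ 1`, so the first exponent alone absorbs all the slack without leaving `[1,2]`.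
  set t := ((n : ℝ) + 2) / 2 - ∑ k : Fin n, 1 / q k.succ with ht
  have hq0 : 0 < q 0 := zero_lt_one.trans_le (hq 0).1
  have h1 : 1 / q 0 ≤ t := by
    rw [Fin.sum_univ_succ] at hsum
    linarith
  have h2 : t ≤ 1 := by
    have : ∑ _k : Fin n, (1 / 2 : ℝ) ≤ ∑ k : Fin n, 1 / q k.succ :=
      Finset.sum_le_sum fun k _ =>
        one_div_le_one_div_of_le (zero_lt_one.trans_le (hq _).1) (hq _).2
    simp at this
    simp only [ht, one_div]
    linarith
  have ht0 : 0 < t := (one_div_pos.2 hq0).trans_le h1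
  have hs : 1 / t ≤ q 0 := (one_div_le ht0 hq0).2 h1
  refine (mixedNorm_cons_le_of_le q (one_div_pos.2 ht0) hs _).trans
    (mixedNorm_le_of_sum_eq _ (fun k => ?_) ?_ A)
  · refine Fin.cases ?_ (fun k => ?_) k
    · exact ⟨(le_one_div zero_lt_one ht0).2 (by simpa using h2), hs.trans (hq 0).2⟩
    · exact hq _
  · rw [Fin.sum_univ_succ]
    simp only [Fin.cons_zero, Fin.cons_succ, one_div_one_div]
    rw [ht]
    ring

/-! ### Hadamard matrices, the extremal form and the necessity of (2). -/

section Hadamard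

variable (𝕜 : Type*) [RCLike 𝕜]

/-- Existence of Hadamard matrices of order `2 ^ k` (Sylvester). -/
lemma exists_hadamard (k : ℕ) : ∃ H : Fin (2 ^ k) → Fin (2 ^ k) → 𝕜, (∀ r s, ‖H r s‖ = 1) ∧
    ∀ w : Fin (2 ^ k) → 𝕜, ∑ s, ‖∑ r, w r * H r s‖ ^ 2 = 2 ^ k * ∑ r, ‖w r‖ ^ 2 := by
  -- The 2 × 2 Hadamard matrix; the matrix sought is its `k`-fold tensor power, indexed by Boolean
  -- strings.
  let h : Bool → Bool → 𝕜 := fun b c => if b then 1 else boolSign 𝕜 c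
  have hh : ∀ b c, ‖h b c‖ = 1 := fun b c => by cases b <;> simp [h, norm_boolSign]
  have key : ∀ w : (Fin k → Bool) → 𝕜,
      ∑ s : Fin k → Bool, ‖∑ r, w r * ∏ i, h (r i) (s i)‖ ^ 2 = 2 ^ k * ∑ r, ‖w r‖ ^ 2 := by
    induction k with
    | zero => simp
    | succ k ih =>
      intro w
      have h1 := ih fun r => w (Fin.cons true r) + w (Fin.cons false r)
      have h2 := ih fun r => w (Fin.cons true r) + -w (Fin.cons false r)
      simp only [sum_fin_succ_tuple (n := k), Fin.prod_univ_succ, Fin.cons_zero, Fin.cons_succ,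
        Fintype.sum_bool]
      simp only [h, boolSign, if_true, Bool.false_eq_true, if_false, one_mul, mul_neg,
        add_mul, neg_mul, Finset.sum_add_distrib, Finset.sum_neg_distrib] at h1 h2 ⊢
      have h3 : ∀ r : Fin k → Bool,
          ‖w (Fin.cons true r) + w (Fin.cons false r)‖ ^ 2 +
            ‖w (Fin.cons true r) + -w (Fin.cons false r)‖ ^ 2 =
          2 * (‖w (Fin.cons true r)‖ ^ 2 + ‖w (Fin.cons false r)‖ ^ 2) := fun r => by
        have := norm_add_sq_add_norm_neg_add_sq 𝕜 (w (Fin.cons false r)) (w (Fin.cons true r))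
        rw [add_comm (w (Fin.cons true r)), add_comm (w (Fin.cons true r)), this, add_comm (‖_‖ ^ 2)]
      rw [h1, h2, ← mul_add, ← Finset.sum_add_distrib, Finset.sum_congr rfl fun r _ => h3 r,
        ← Finset.mul_sum, Finset.sum_add_distrib]
      ring
  have hcard : Fintype.card (Fin k → Bool) = 2 ^ k := by simp
  let e := Fintype.equivFinOfCardEq hcard
  refine ⟨fun r s => ∏ i, h (e.symm r i) (e.symm s i), fun r s => ?_, fun w => ?_⟩
  · simp [norm_prod, hh]
  · rw [← e.sum_comp]
    simpa [← e.sum_comp] using key fun r => w (e r)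

end Hadamard

section Form

variable {𝕜 : Type*} [RCLike 𝕜]

/-- The vector `w` is there for the induction. Summing out the first index multiplies `w` by `x 0`
and applies `H`, which enlarges its ℓ₂ norm by at most `√n * B 0`; the last index is handled by
Cauchy–Schwarz. Taking `w = 1` later contributes one more `√n`. -/
lemma norm_chain_sum_le {n : ℕ} {H : Fin n → Fin n → 𝕜}
    (hH : ∀ w : Fin n → 𝕜, ∑ s, ‖∑ r, w r * H r s‖ ^ 2 ≤ n * ∑ r, ‖w r‖ ^ 2) (m : ℕ)
    (x : Fin (m + 1) → Fin n → 𝕜) (B : Fin (m + 1) → ℝ) (hx : ∀ k j, ‖x k j‖ ≤ B k)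
    (hB : ∀ k, 0 ≤ B k) (w : Fin n → 𝕜) :
    ‖∑ r : Fin (m + 1) → Fin n, w (r 0) *
      ((∏ k : Fin m, H (r k.castSucc) (r k.succ)) * ∏ k, x k (r k))‖ ≤
      √(∑ j, ‖w j‖ ^ 2) * (√n ^ (m + 1) * ∏ k, B k) := by
  induction m generalizing w with
  | zero =>
    rw [sum_fin_succ_tuple]
    simp only [Finset.univ_eq_empty, Finset.prod_empty, one_mul, Fin.prod_univ_succ, Fin.cons_zero,
      mul_one, Finset.univ_unique, Finset.sum_const, Finset.card_singleton, one_smul, zero_add,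
      pow_one]
    calc _ ≤ ∑ j, ‖w j‖ * B 0 := (norm_sum_le _ _).trans (Finset.sum_le_sum fun j _ => by
          rw [norm_mul]
          exact mul_le_mul_of_nonneg_left (hx 0 j) (norm_nonneg _))
      _ = (∑ j, ‖w j‖ * 1) * B 0 := by simp [Finset.sum_mul]
      _ ≤ (√(∑ j, ‖w j‖ ^ 2) * √(∑ _j : Fin n, 1 ^ 2)) * B 0 :=
          mul_le_mul_of_nonneg_right (Real.sum_mul_le_sqrt_mul_sqrt _ _ _) (hB 0)
      _ = _ := by simp [mul_assoc]
  | succ m ih =>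
    have h := ih (fun k => x k.succ) (fun k => B k.succ) (fun k => hx _) (fun k => hB _)
      (fun s => ∑ j, (w j * x 0 j) * H j s)
    have heq : ∑ r : Fin (m + 2) → Fin n, w (r 0) *
        ((∏ k : Fin (m + 1), H (r k.castSucc) (r k.succ)) * ∏ k, x k (r k)) =
        ∑ r : Fin (m + 1) → Fin n, (∑ j, (w j * x 0 j) * H j (r 0)) *
          ((∏ k : Fin m, H (r k.castSucc) (r k.succ)) * ∏ k, x k.succ (r k)) := by
      rw [sum_fin_succ_tuple, Finset.sum_comm]
      refine Finset.sum_congr rfl fun r _ => ?_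
      rw [Finset.sum_mul]
      refine Finset.sum_congr rfl fun j _ => ?_
      rw [Fin.prod_univ_succ, Fin.prod_univ_succ (fun k => x k _)]
      simp only [Fin.castSucc_zero, Fin.cons_zero, Fin.cons_succ, ← Fin.succ_castSucc]
      ring
    rw [heq]
    refine h.trans ?_
    have hw : √(∑ s, ‖∑ j, (w j * x 0 j) * H j s‖ ^ 2) ≤ √(∑ j, ‖w j‖ ^ 2) * (√n * B 0) := by
      rw [← Real.sqrt_sq (hB 0), ← Real.sqrt_mul (Nat.cast_nonneg n),
        ← Real.sqrt_mul (by positivity)]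
      refine Real.sqrt_le_sqrt ((hH _).trans ?_)
      calc (n : ℝ) * ∑ j, ‖w j * x 0 j‖ ^ 2 ≤ n * ∑ j, ‖w j‖ ^ 2 * B 0 ^ 2 := by
            refine mul_le_mul_of_nonneg_left (Finset.sum_le_sum fun j _ => ?_) (Nat.cast_nonneg n)
            rw [norm_mul, mul_pow]
            have := hx 0 j
            gcongr
        _ = _ := by rw [← Finset.sum_mul]; ring
    have hP : 0 ≤ ∏ k : Fin (m + 1), B k.succ := Finset.prod_nonneg fun k _ => hB _
    calc _ ≤ √(∑ j, ‖w j‖ ^ 2) * (√n * B 0) * (√n ^ (m + 1) * ∏ k : Fin (m + 1), B k.succ) :=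
          mul_le_mul_of_nonneg_right hw (by positivity)
      _ = _ := by rw [Fin.prod_univ_succ B]; ring

/-- Evaluation at `n` on `c₀`, as a continuous linear functional. -/
noncomputable def c0Eval (n : ℕ) : C₀(ℕ, 𝕜) →L[𝕜] 𝕜 :=
  LinearMap.mkContinuous
    { toFun := fun f => f n
      map_add' := fun _ _ => rfl
      map_smul' := fun _ _ => rfl } 1
    fun f => by simpa using f.norm_apply_le n

lemma c0Eval_apply (n : ℕ) (f : C₀(ℕ, 𝕜)) : c0Eval n f = f n := rfl

/-- The multilinear form on `c₀` with coefficients `c` on the box `{0, …, n - 1} ^ m`. -/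
noncomputable def boxForm {m n : ℕ} (c : (Fin m → Fin n) → 𝕜) :
    ContinuousMultilinearMap 𝕜 (fun _ : Fin m => C₀(ℕ, 𝕜)) 𝕜 :=
  ∑ r, c r • (ContinuousMultilinearMap.mkPiAlgebra 𝕜 (Fin m) 𝕜).compContinuousLinearMap
    fun k => c0Eval (r k)

lemma boxForm_apply {m n : ℕ} (c : (Fin m → Fin n) → 𝕜) (x : Fin m → C₀(ℕ, 𝕜)) :
    boxForm c x = ∑ r, c r * ∏ k, x k (r k) := by
  simp [boxForm, c0Eval_apply]

lemma boxForm_c0Basis {m n : ℕ} (c : (Fin m → Fin n) → 𝕜) (r : Fin m → Fin n) :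
    boxForm c (fun k => c0Basis 𝕜 (r k)) = c r := by
  rw [boxForm_apply, Finset.sum_eq_single r]
  · simp [c0Basis_apply]
  · intro r' _ hr
    obtain ⟨k, hk⟩ := Function.ne_iff.1 hr
    rw [Finset.prod_eq_zero (Finset.mem_univ k), mul_zero]
    rw [c0Basis_apply, Pi.single_eq_of_ne]
    exact fun h => hk (Fin.ext h)
  · simp

/-- There are `m`-linear forms with unimodular coefficients on a box of side `n = 2 ^ k`
and norm at most `n ^ ((m + 1) / 2)`. -/
lemma exists_unimodular_form (𝕜 : Type*) [RCLike 𝕜] (m k : ℕ) :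
    ∃ A : ContinuousMultilinearMap 𝕜 (fun _ : Fin (m + 1) => C₀(ℕ, 𝕜)) 𝕜,
      (∀ i : Fin (m + 1) → ℕ, (∀ l, i l < 2 ^ k) → ‖A (fun l => c0Basis 𝕜 (i l))‖ = 1) ∧
        ‖A‖ ≤ √(2 ^ k) ^ (m + 2) := by
  obtain ⟨H, hH1, hH⟩ := exists_hadamard 𝕜 k
  refine ⟨boxForm fun r => ∏ l : Fin m, H (r l.castSucc) (r l.succ), fun i hi => ?_, ?_⟩
  · have := boxForm_c0Basis (𝕜 := 𝕜) (fun r : Fin (m + 1) → Fin (2 ^ k) =>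
      ∏ l : Fin m, H (r l.castSucc) (r l.succ)) fun l => ⟨i l, hi l⟩
    simp only at this
    rw [this, norm_prod]
    simp [hH1]
  · refine ContinuousMultilinearMap.opNorm_le_bound (by positivity) fun x => ?_
    rw [boxForm_apply]
    have := norm_chain_sum_le (H := H) (fun w => by simpa using (hH w).le) m
      (fun l j => x l j) (fun l => ‖x l‖) (fun l j => (x l).norm_apply_le j)
      (fun l => norm_nonneg _) fun _ => 1
    simp only [one_mul] at this
    refine this.trans (le_of_eq ?_)
    simp
    ring

end Form

lemma rpow_sum_le_mixedNorm {n : ℕ} (hn : 0 < n) (m : ℕ) (q : Fin m → ℝ) (hq : ∀ k, 0 < q k)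
    (a : (Fin m → ℕ) → ℝ≥0∞) (ha : ∀ i, (∀ k, i k < n) → 1 ≤ a i) :
    (n : ℝ≥0∞) ^ ∑ k, 1 / q k ≤ mixedNorm m q a := by
  induction m with
  | zero => simpa [mixedNorm] using ha _ fun k => k.elim0
  | succ m ih =>
    have hn0 : (n : ℝ≥0∞) ≠ 0 := by exact_mod_cast hn.ne'
    have hntop : (n : ℝ≥0∞) ≠ ∞ := ENNReal.natCast_ne_top n
    rw [mixedNorm, Fin.sum_univ_succ, ENNReal.rpow_add _ _ hn0 hntop]
    have h0 := (hq 0).ne'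
    calc _ = (∑ _i ∈ Finset.range n, ((n : ℝ≥0∞) ^ ∑ k : Fin m, 1 / q k.succ) ^ q 0) ^
          (1 / q 0) := by
          rw [Finset.sum_const, Finset.card_range, nsmul_eq_mul,
            ENNReal.mul_rpow_of_nonneg _ _ (one_div_nonneg.2 (hq 0).le), ← ENNReal.rpow_mul _ (q 0),
            mul_one_div_cancel h0, ENNReal.rpow_one]
      _ ≤ _ := by
          refine ENNReal.rpow_le_rpow (le_trans (Finset.sum_le_sum fun i hi => ?_)
            (ENNReal.sum_le_tsum (Finset.range n))) (one_div_nonneg.2 (hq 0).le)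
          refine ENNReal.rpow_le_rpow (ih _ (fun k => hq _) _ fun r hr => ha _ fun k => ?_)
            (hq 0).le
          refine Fin.cases ?_ (fun k => ?_) k
          · simpa using hi
          · simpa using hr k

lemma sum_le_of_mixedNorm_le (𝕜 : Type*) [RCLike 𝕜] {m : ℕ} (q : Fin (m + 1) → ℝ)
    (hq : ∀ k, 0 < q k) {C : ℝ} (hC : 0 ≤ C)
    (h : ∀ A : ContinuousMultilinearMap 𝕜 (fun _ : Fin (m + 1) => C₀(ℕ, 𝕜)) 𝕜,
      mixedNorm (m + 1) q (fun i => ‖A (fun k => c0Basis 𝕜 (i k))‖ₑ) ≤ ENNReal.ofReal (C * ‖A‖)) :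
    ∑ k, 1 / q k ≤ ((m : ℝ) + 2) / 2 := by
  set S := ∑ k, 1 / q k with hS
  by_contra! hlt
  -- With `N = 2 ^ k`, testing on the unimodular form gives `N ^ S ≤ C * N ^ ((m + 2) / 2)`. If `S`
  -- were too large, this would bound a geometric sequence of ratio greater than 1.
  have hbound : ∀ k : ℕ, ((2 : ℝ) ^ (S - ((m : ℝ) + 2) / 2)) ^ k ≤ C := by
    intro k
    obtain ⟨A, hA1, hA⟩ := exists_unimodular_form 𝕜 m k
    have h1 := (rpow_sum_le_mixedNorm (n := 2 ^ k) (by positivity) (m + 1) q hq _ fun i hi => by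
      rw [← ofReal_norm, hA1 i hi, ENNReal.ofReal_one]).trans (h A)
    have hT : √((2 : ℝ) ^ k) ^ (m + 2) = ((2 : ℝ) ^ k) ^ (((m : ℝ) + 2) / 2) := by
      rw [Real.sqrt_eq_rpow, ← Real.rpow_natCast, ← Real.rpow_mul (by positivity)]
      congr 1
      push_cast
      ring
    rw [hT] at hA
    have h2 : ((2 : ℝ) ^ k) ^ S ≤ C * ‖A‖ := by
      rw [← ENNReal.ofReal_le_ofReal_iff (by positivity),
        ← ENNReal.ofReal_rpow_of_pos (by positivity)]
      refine le_trans (le_of_eq ?_) h1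
      rw [ENNReal.ofReal_pow (by norm_num), hS]
      simp
    have h3 := h2.trans (mul_le_mul_of_nonneg_left hA hC)
    rw [← Real.rpow_natCast, ← Real.rpow_mul two_pos.le, mul_comm _ (k : ℝ),
      Real.rpow_mul two_pos.le, Real.rpow_natCast, Real.rpow_sub (by positivity),
      div_le_iff₀ (by positivity)]
    exact h3
  obtain ⟨k, hk⟩ := pow_unbounded_of_one_lt C
    (Real.one_lt_rpow one_lt_two (sub_pos.2 hlt))
  exact absurd (hbound k) (not_le.2 hk)

theorem theorem1p1 (𝕜 : Type*) [RCLike 𝕜] (m : ℕ) (hm : 1 ≤ m) :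
    (∀ q : Fin m → ℝ, (∀ k, q k ∈ Set.Icc (1 : ℝ) 2) →
      ((∃ C : ℝ, 1 ≤ C ∧
          ∀ A : ContinuousMultilinearMap 𝕜 (fun _ : Fin m => C₀(ℕ, 𝕜)) 𝕜,
            mixedNorm m q (fun i => ‖A (fun k => c0Basis 𝕜 (i k))‖ₑ) ≤ ENNReal.ofReal (C * ‖A‖)) ↔
        ∑ k, 1 / q k ≤ ((m : ℝ) + 1) / 2)) ∧
    (∃ C : ℝ, 1 ≤ C ∧
      ∀ A : ContinuousMultilinearMap 𝕜 (fun _ : Fin m => C₀(ℕ, 𝕜)) 𝕜,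
        (∑' i : Fin m → ℕ,
            ‖A (fun k => c0Basis 𝕜 (i k))‖ₑ ^ (2 * (m : ℝ) / ((m : ℝ) + 1))) ^
              (((m : ℝ) + 1) / (2 * (m : ℝ))) ≤
          ENNReal.ofReal (C * ‖A‖)) := by
  obtain ⟨n, rfl⟩ := Nat.exists_eq_add_of_le' hm
  have hcast : (((n + 1 : ℕ) : ℝ) + 1) / 2 = ((n : ℝ) + 2) / 2 := by
    push_cast
    ring
  have hC : (1 : ℝ) ≤ (9 / 5) ^ n := one_le_pow₀ (by norm_num)
  refine ⟨fun q hq => ⟨?_, fun h => ?_⟩, (9 / 5) ^ n, hC, fun A => ?_⟩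
  · rintro ⟨C, hC1, h⟩
    rw [hcast]
    exact sum_le_of_mixedNorm_le 𝕜 q (fun k => zero_lt_one.trans_le (hq k).1)
      (zero_le_one.trans hC1) h
  · exact ⟨(9 / 5) ^ n, hC, mixedNorm_le_of_sum_le q hq (hcast ▸ h)⟩
  · set M : ℝ := ((n + 1 : ℕ) : ℝ) with hM
    have hM1 : 1 ≤ M := by simp [hM]
    -- Bohnenblust–Hille is the point of the hyperplane with all exponents equal; it lies in `[1,2]`
    -- because `M ≥ 1`.
    have h := mixedNorm_le_of_sum_le (fun _ : Fin (n + 1) => 2 * M / (M + 1))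
      (fun _ => ⟨by rw [le_div_iff₀ (by positivity)]; linarith,
        by rw [div_le_iff₀ (by positivity)]; linarith⟩) (by
        rw [← hcast]
        simp only [Finset.sum_const, Finset.card_univ, Fintype.card_fin, nsmul_eq_mul, ← hM]
        have : M ≠ 0 := by positivity
        exact le_of_eq (by field_simp)) A
    rwa [mixedNorm_const (by positivity), one_div_div] at h
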